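/- For a convex body $K$ in $\mathbb{R}^n$ (a compact convex set with non-empty interior) write $|K|$ for its volume and $S(K)$ for its surface area (the $(n-1)$-dimensional Hausdorff measure of its boundary), and put $$\partial(K)=\min_{T\in GL(n)}\frac{S(TK)}{|TK|^{(n-1)/n}},\qquad vr(K)=\Big(\frac{|K|}{|JK|}\Big)^{1/n},$$ where $JK$ is the ellipsoid of maximal volume contained in $K$. Call $K$ 1-symmetric if its symmetry group contains the symmetry group of the standard cube $[-1,1]^n$. Let $D_n$ be the Euclidean ball in $\mathbb{R}^n$ with centre $0$ and volume $1$, and let $B_\infty^n=[-1,1]^n$. Theorem. There is an absolute constant $c'>0$ such that for every integer $n\ge 1$ there is a number $s_0>0$ for which $$K=D_n\cap s_0B_\infty^n$$ is a 1-symmetric convex body with $|K|=1/2$ and $$\partial(K)\le c'\,vr(K)\sqrt{\log(n+1)}.$$ Consequently, the inequality $\partial(K)\le c\sqrt n\,vr(K)$ cannot be reversed for general symmetric convex bodies: there is no absolute constant $c>0$ such that $c\sqrt n\,vr(K)\le\partial(K)$ for all $n\ge 1$ and all convex bodies $K$ in $\mathbb{R}^n$ with $K=-K$. -/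

import Mathlib

open MeasureTheory Set
open scoped ENNReal Pointwise

noncomputable section

namespace MinSurf

variable {n : ℕ}

/-- The volume `ω_n` of the Euclidean ball of radius `1` in `ℝⁿ`. -/
def omega (n : ℕ) : ℝ :=
  (volume (Metric.closedBall (0 : EuclideanSpace ℝ (Fin n)) 1)).toReal

/-- `D_n`: the Euclidean ball of `ℝⁿ` with centre `0` and volume `1` (for `n ≥ 1`), that is, the
ball of radius `ω_n ^ (-1 / n)`. -/
def unitVolumeBall (n : ℕ) : Set (EuclideanSpace ℝ (Fin n)) :=
  Metric.closedBall 0 (omega n ^ (-1 / (n : ℝ)))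

/-- `B_∞^n`, the unit ball of `ℓ_∞^n`; it is also the standard cube `[-1, 1]^n`. -/
def supBall (n : ℕ) : Set (EuclideanSpace ℝ (Fin n)) :=
  {x | ∀ i, |x i| ≤ 1}

/-- The group of linear isometries of `ℝⁿ` that map `A` onto itself. (Every isometry
that maps the cube `[-1, 1]^n` onto itself fixes its centre `0`, hence is linear.) -/
def symmetryGroup (A : Set (EuclideanSpace ℝ (Fin n))) :
    Set (EuclideanSpace ℝ (Fin n) ≃ₗᵢ[ℝ] EuclideanSpace ℝ (Fin n)) :=
  {g | g '' A = A}

/-- `A` is 1-symmetric: its symmetry group contains that of the standard cube. -/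
def IsOneSymmetric (A : Set (EuclideanSpace ℝ (Fin n))) : Prop :=
  symmetryGroup (supBall n) ⊆ symmetryGroup A

/-- The surface area `S(K)`: the `(n-1)`-dimensional Hausdorff measure of the boundary, normalized
so that it agrees with Lebesgue measure on hyperplanes. -/
def surfaceArea (K : Set (EuclideanSpace ℝ (Fin n))) : ℝ≥0∞ :=
  μHE[n - 1] (frontier K)

/-- The affine invariant `∂(K)`: the least value of `S(TK) / |TK| ^ ((n-1)/n)` over `T ∈ GL(n)`. -/
def minSurface (K : Set (EuclideanSpace ℝ (Fin n))) : ℝ≥0∞ :=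
  ⨅ T : EuclideanSpace ℝ (Fin n) ≃L[ℝ] EuclideanSpace ℝ (Fin n),
    surfaceArea (T '' K) / volume (T '' K) ^ (((n : ℝ) - 1) / n)

/-- An ellipsoid: the image of the Euclidean unit ball under an invertible affine map. -/
def IsEllipsoid (A : Set (EuclideanSpace ℝ (Fin n))) : Prop :=
  ∃ (T : EuclideanSpace ℝ (Fin n) ≃L[ℝ] EuclideanSpace ℝ (Fin n)) (b : EuclideanSpace ℝ (Fin n)),
    A = (fun x => T x + b) '' Metric.closedBall 0 1

/-- The volume `|JK|` of the John ellipsoid: the largest volume of an ellipsoid contained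
in `K`. -/
def johnVolume (K : Set (EuclideanSpace ℝ (Fin n))) : ℝ≥0∞ :=
  ⨆ (A : Set (EuclideanSpace ℝ (Fin n))) (_ : IsEllipsoid A ∧ A ⊆ K), volume A

/-- The volume ratio `vr(K) = (|K| / |JK|) ^ (1/n)`. -/
def volumeRatio (K : Set (EuclideanSpace ℝ (Fin n))) : ℝ≥0∞ :=
  (volume K / johnVolume K) ^ (1 / (n : ℝ))

end MinSurf

end

/-!
The body `K = D_n ∩ [-s, s]ⁿ` is bounded from two sides. Let `r ~ √n` be the radius of `D_n`.

*Surface area.* Since `K` lies in the ball of radius `r`, its surface area is at most that of the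
ball, which is `n |D_n| / r = n / r` (`mul_euclideanHausdorffMeasure_frontier_le`). To avoid computing
the Hausdorff measure of a sphere, both facts are obtained at once. Circumscribe about the ball a
polytope `P` whose facet normals form a finite `ε`-net, so that `P ⊆ (1 - ε)⁻¹ rB`. The metric
projection to `K` is 1-Lipschitz and maps the union of the facets onto a set containing `∂K`
(`frontier_subset_image_facet`), and the facets have total area at most `n |P| / r`, because the
cones over them are disjoint in `P` and obey the pyramid formula
(`mul_euclideanHausdorffMeasure_iUnion_facet_le`). Then `ε → 0`.

*Volume ratio.* By Hadamard's inequality an ellipsoid in `[-s, s]ⁿ` is no larger than the ball of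
radius `s` (`IsEllipsoid.volume_le_of_subset_cube`), so `vr(K) ≥ r / (2 s)`.

*The truncation level.* The cap of `D_n` at distance `s` from the centre fits into a ball of radius
`√(r² - s²)`, and has volume at most `exp (-n s² / (2 r²)) ≤ exp (-2 s²)` since `r² ≤ n / 4`. A union
bound over `2n` caps shows that `s = √(log (n + 1))` keeps at least half of the volume, and by
continuity some smaller `s` keeps exactly half (`exists_truncation`).

Together, `∂(K) ≤ 2 n / r` and `vr(K) √(log (n + 1)) ≥ r / 2`, and `r² ≥ n / (2 π e)` by comparison
with a Gaussian integral. Hence the constant `8 π e`. As `√(log (n + 1)) / √n → 0` and the volume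
ratio is positive and finite, the reverse inequality fails on these bodies.
-/

namespace MinSurf

/-! ### Cones over the facets of a circumscribed polytope -/

section Cone

variable {V : Type*} [NormedAddCommGroup V] [InnerProductSpace ℝ V] [FiniteDimensional ℝ V]
  [MeasurableSpace V] [BorelSpace V]

/-- The open cone with apex `0` over a set `F` contained in the hyperplane `⟪u, x⟫ = r`; it is
described by the radial projection to that hyperplane, which makes measurability immediate. -/
def openCone (u : V) (r : ℝ) (F : Set V) : Set V :=
  {x | inner ℝ u x ∈ Ioo 0 r ∧ (r / inner ℝ u x) • x ∈ F}

lemma measurableSet_openCone (u : V) (r : ℝ) {F : Set V} (hF : MeasurableSet F) :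
    MeasurableSet (openCone u r F) := by
  have h1 : Measurable fun x : V => inner ℝ u x := by fun_prop
  have h2 : Measurable fun x : V => (r / inner ℝ u x) • x := (h1.const_div r).smul measurable_id
  exact (h1 measurableSet_Ioo).inter (h2 hF)

lemma lintegral_Ioo_div_pow {r : ℝ} (hr : 0 < r) (m : ℕ) :
    ∫⁻ x in Ioo 0 r, ENNReal.ofReal ((x / r) ^ m) = ENNReal.ofReal (r / (m + 1)) := by
  rw [Measure.restrict_congr_set Ioo_ae_eq_Ioc, ← ofReal_integral_eq_lintegral_ofReal]
  · rw [← intervalIntegral.integral_of_le hr.le]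
    congr 1
    simp only [div_pow, intervalIntegral.integral_div, integral_pow]
    field_simp
    simp [pow_succ]
  · exact (Continuous.integrableOn_Icc (by fun_prop)).mono_set Ioc_subset_Icc_self
  · refine (ae_restrict_iff' measurableSet_Ioc).2 (ae_of_all _ fun x hx => ?_)
    have := hx.1
    positivity

/-- The pyramid formula `|C| = r |F| / d`, as an inequality: slicing the cone over `F` by the
hyperplanes orthogonal to `u` gives homothetic copies of `F`. -/
lemma mul_euclideanHausdorffMeasure_le_volume_openCone {u : V} (hu : ‖u‖ = 1) {r : ℝ} (hr : 0 < r)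
    {F : Set V} (hF : MeasurableSet F) (hFu : ∀ x ∈ F, inner ℝ u x = r) :
    ENNReal.ofReal (r / Module.finrank ℝ V) * μHE[Module.finrank ℝ V - 1] F
      ≤ volume (openCone u r F) := by
  have hu0 : u ≠ 0 := by
    rintro rfl
    simp at hu
  have hd : 0 < Module.finrank ℝ V := Module.finrank_pos_iff_exists_ne_zero.2 ⟨u, hu0⟩
  obtain ⟨m, hm⟩ : ∃ m, Module.finrank ℝ V = m + 1 := ⟨Module.finrank ℝ V - 1, by omega⟩
  have huu : inner ℝ u u = 1 := by rw [real_inner_self_eq_norm_sq, hu]; norm_num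
  rw [← InnerProductSpace.euclideanHausdorffMeasure_eq_volume,
    EuclideanGeometry.euclideanHausdorffMeasure_eq_lintegral (0 : V) hu0
      (measurableSet_openCone u r hF)]
  have hue : ‖u‖ₑ = 1 := by rw [← ofReal_norm, hu]; simp
  rw [hue, one_mul, hm, Nat.add_sub_cancel]
  calc ENNReal.ofReal (r / ((m + 1 : ℕ) : ℝ)) * μHE[m] F
      = ∫⁻ x in Ioo 0 r, ENNReal.ofReal ((x / r) ^ m) * μHE[m] F := by
        rw [lintegral_mul_const _ (by fun_prop), lintegral_Ioo_div_pow hr]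
        push_cast; rfl
    _ ≤ ∫⁻ x in Ioo 0 r, μHE[m] (openCone u r F ∩
          (AffineSubspace.mk' (x • u +ᵥ (0 : V)) (ℝ ∙ u)ᗮ : Set V)) := by
        refine setLIntegral_mono' measurableSet_Ioo fun x hx => ?_
        have hxr : 0 < x / r := div_pos hx.1 hr
        have hsub : (x / r) • F ⊆ openCone u r F ∩
            (AffineSubspace.mk' (x • u +ᵥ (0 : V)) (ℝ ∙ u)ᗮ : Set V) := by
          rintro _ ⟨y, hy, rfl⟩
          have hi : inner ℝ u ((x / r) • y) = x := by
            rw [inner_smul_right, hFu y hy, div_mul_cancel₀ _ hr.ne']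
          refine ⟨⟨by simpa only [hi] using hx, ?_⟩, ?_⟩
          · simp only [hi, smul_smul]
            rw [div_mul_div_cancel₀ hx.1.ne', div_self hr.ne', one_smul]
            exact hy
          · simp only [SetLike.mem_coe, AffineSubspace.mem_mk', vadd_eq_add, add_zero,
              vsub_eq_sub, Submodule.mem_orthogonal_singleton_iff_inner_right]
            rw [inner_sub_right, hi, inner_smul_right, huu, mul_one, sub_self]
        refine le_trans (le_of_eq ?_) (measure_mono hsub)
        rw [Measure.euclideanHausdorffMeasure_smul₀ _ hxr.ne', ENNReal.smul_def, smul_eq_mul]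
        congr 1
        rw [ENNReal.ofReal_pow hxr.le, ENNReal.coe_pow]
        congr 1
        rw [← enorm_eq_nnnorm, Real.enorm_of_nonneg hxr.le]
    _ ≤ _ := setLIntegral_le_lintegral _ _

/-- The facet of the polytope `⋂ j, {x | ⟪u j, x⟫ ≤ r}` in the direction `u i`. -/
def facet {ι : Type*} (u : ι → V) (r : ℝ) (i : ι) : Set V :=
  {x | inner ℝ (u i) x = r ∧ ∀ j, inner ℝ (u j) x ≤ r}

/-- The surface area of a polytope all of whose facets touch the ball of radius `r` is at most
`d |P| / r`: the cones over the facets are disjoint subsets of `P`. -/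
lemma mul_euclideanHausdorffMeasure_iUnion_facet_le {N : ℕ} {u : Fin N → V} (hu : ∀ i, ‖u i‖ = 1)
    {r : ℝ} (hr : 0 < r) :
    ENNReal.ofReal (r / Module.finrank ℝ V) * μHE[Module.finrank ℝ V - 1] (⋃ i, facet u r i)
      ≤ volume {x : V | ∀ i, inner ℝ (u i) x ≤ r} := by
  have hFm : ∀ i, MeasurableSet (facet u r i) := fun i => by
    have h : facet u r i = {x | inner ℝ (u i) x = r} ∩ ⋂ j, {x : V | inner ℝ (u j) x ≤ r} := by
      ext x
      simp [facet]
    rw [h]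
    exact ((isClosed_eq (by fun_prop) continuous_const).inter
      (isClosed_iInter fun j => isClosed_le (by fun_prop) continuous_const)).measurableSet
  -- Facets may overlap in lower-dimensional faces; each point is kept in one facet only.
  set G := disjointed (facet u r) with hG
  have hGF : ∀ i, G i ⊆ facet u r i := fun i => disjointed_le _ i
  have hGm : ∀ i, MeasurableSet (G i) := fun i => disjointedRec (fun _ j ht => ht.diff (hFm j)) (hFm i)
  have key : ∀ i j x, x ∈ openCone (u i) r (G i) → inner ℝ (u j) x ≤ inner ℝ (u i) x := by
    intro i j x hx
    have h1 := (hGF i hx.2).2 j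
    rw [inner_smul_right, div_mul_eq_mul_div, div_le_iff₀ hx.1.1] at h1
    exact le_of_mul_le_mul_left h1 hr
  have hdisj : Pairwise (Function.onFun Disjoint fun i => openCone (u i) r (G i)) := by
    intro i j hij
    refine Set.disjoint_left.2 fun x hi hj => ?_
    have he : inner ℝ (u i) x = inner ℝ (u j) x := le_antisymm (key j i x hj) (key i j x hi)
    have h2 := hj.2
    rw [← he] at h2
    exact Set.disjoint_left.1 (disjoint_disjointed (facet u r) hij) hi.2 h2
  calc _ ≤ ENNReal.ofReal (r / Module.finrank ℝ V) *
        ∑ i, μHE[Module.finrank ℝ V - 1] (G i) := by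
        rw [← iUnion_disjointed]
        gcongr
        exact (measure_iUnion_le _).trans (tsum_fintype _).le
    _ ≤ ∑ i, volume (openCone (u i) r (G i)) := by
        rw [Finset.mul_sum]
        exact Finset.sum_le_sum fun i _ =>
          mul_euclideanHausdorffMeasure_le_volume_openCone (hu i) hr (hGm i)
            fun x hx => (hGF i hx).1
    _ = volume (⋃ i, openCone (u i) r (G i)) := by
        rw [measure_iUnion hdisj fun i => measurableSet_openCone _ _ (hGm i), tsum_fintype]
    _ ≤ _ := by
        refine measure_mono (iUnion_subset fun i x hx j => ?_)
        exact (key i j x hx).trans hx.1.2.le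

end Cone

/-! ### Metric projection and surface area inside a ball -/

section Projection

variable {V : Type*} [NormedAddCommGroup V] [InnerProductSpace ℝ V]

/-- The Hilbert projection to a complete convex set, with its variational characterization. -/
lemma exists_metricProjection {K : Set V} (hne : K.Nonempty) (hK : IsComplete K)
    (hconv : Convex ℝ K) :
    ∃ p : V → V, ∀ z, p z ∈ K ∧ ∀ y ∈ K, inner ℝ (z - p z) (y - p z) ≤ 0 := by
  choose p hp using exists_norm_eq_iInf_of_complete_convex hne hK hconv
  exact ⟨p, fun z => ⟨(hp z).1, (norm_eq_iInf_iff_real_inner_le_zero hconv (hp z).1).1 (hp z).2⟩⟩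

lemma norm_sub_le_of_inner_nonpos {x x' z z' : V} (h : inner ℝ (z - x) (x' - x) ≤ 0)
    (h' : inner ℝ (z' - x') (x - x') ≤ 0) : ‖x - x'‖ ≤ ‖z - z'‖ := by
  have h1 : ‖x - x'‖ * ‖x - x'‖ ≤ inner ℝ (z - z') (x - x') := by
    rw [← real_inner_self_eq_norm_mul_norm]
    have h2 : inner ℝ (z - x) (x' - x) = - inner ℝ (z - x) (x - x') := by
      rw [← inner_neg_right, neg_sub]
    have h3 : inner ℝ (z - z') (x - x') - inner ℝ (x - x') (x - x')
        = inner ℝ (z - x) (x - x') - inner ℝ (z' - x') (x - x') := by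
      rw [← inner_sub_left, ← inner_sub_left]
      congr 1
      abel
    linarith
  have h4 := h1.trans (real_inner_le_norm _ _)
  rcases (norm_nonneg (x - x')).eq_or_lt with h0 | h0
  · rw [← h0]; positivity
  · exact le_of_mul_le_mul_right h4 h0

/-- A convex set with non-empty interior has an outer normal vector at every boundary point. -/
lemma exists_outer_normal [CompleteSpace V] {K : Set V} (hconv : Convex ℝ K)
    (hint : (interior K).Nonempty) {x : V} (hx : x ∈ frontier K) :
    ∃ w : V, w ≠ 0 ∧ ∀ y ∈ K, inner ℝ w (y - x) ≤ 0 := by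
  obtain ⟨f, hf⟩ := geometric_hahn_banach_open_point hconv.interior isOpen_interior hx.2
  refine ⟨(InnerProductSpace.toDual ℝ V).symm f, ?_, fun y hy => ?_⟩
  · intro h0
    have hf0 : f = 0 := by simpa using h0
    obtain ⟨y, hy⟩ := hint
    simpa [hf0] using hf y hy
  · rw [InnerProductSpace.toDual_symm_apply, map_sub, sub_nonpos]
    have hy' : y ∈ closure (interior K) := by
      rw [hconv.closure_interior_eq_closure_of_nonempty_interior hint]
      exact subset_closure hy
    exact closure_minimal (fun a ha => (hf a ha).le)
      (isClosed_le f.continuous continuous_const) hy'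

/-- A finite `ε`-net of the unit sphere. -/
lemma exists_finite_net [FiniteDimensional ℝ V] {ε : ℝ} (hε : 0 < ε) :
    ∃ (N : ℕ) (u : Fin N → V), (∀ i, ‖u i‖ = 1) ∧
      ∀ x ≠ 0, ∃ i, (1 - ε) * ‖x‖ ≤ inner ℝ (u i) x := by
  obtain ⟨t, hts, htf, hcov⟩ := (isCompact_sphere (0 : V) 1).finite_cover_balls hε
  obtain ⟨N, ⟨e⟩⟩ := htf.exists_equiv_fin
  refine ⟨N, fun i => (e.symm i : V), fun i => by simpa using hts (e.symm i).2, fun x hx => ?_⟩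
  have hx' : 0 < ‖x‖ := norm_pos_iff.2 hx
  have hv : ‖‖x‖⁻¹ • x‖ = 1 := by
    rw [norm_smul, norm_inv, norm_norm, inv_mul_cancel₀ hx'.ne']
  have hmem := hcov (show ‖x‖⁻¹ • x ∈ Metric.sphere (0 : V) 1 by simpa using hv)
  simp only [mem_iUnion] at hmem
  obtain ⟨y, hy, hxy⟩ := hmem
  refine ⟨e ⟨y, hy⟩, ?_⟩
  simp only [Equiv.symm_apply_apply]
  rw [Metric.mem_ball, dist_eq_norm] at hxy
  have h1 : inner ℝ (‖x‖⁻¹ • x - y) x ≤ ε * ‖x‖ :=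
    (real_inner_le_norm _ _).trans (by gcongr)
  rw [inner_sub_left, inner_smul_left, real_inner_self_eq_norm_mul_norm] at h1
  have h2 : (starRingEnd ℝ) ‖x‖⁻¹ * (‖x‖ * ‖x‖) = ‖x‖ := by
    simp [hx'.ne']
  linarith

variable [FiniteDimensional ℝ V]

/-- Every boundary point of a convex body inside a bounded polytope is the metric projection of a
point on a facet: follow an outer normal ray until it leaves the polytope. -/
lemma frontier_subset_image_facet {K : Set V} (hK : IsClosed K) (hconv : Convex ℝ K)
    (hint : (interior K).Nonempty) {p : V → V}
    (hp : ∀ z, p z ∈ K ∧ ∀ y ∈ K, inner ℝ (z - p z) (y - p z) ≤ 0) {N : ℕ} {u : Fin N → V} {r c : ℝ}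
    (hKr : ∀ x ∈ K, ∀ i, inner ℝ (u i) x ≤ r) (hc : 0 < c)
    (hu : ∀ x ≠ 0, ∃ i, c * ‖x‖ ≤ inner ℝ (u i) x) :
    frontier K ⊆ p '' ⋃ i, facet u r i := by
  intro x hx
  have hxK : x ∈ K := hK.frontier_subset hx
  obtain ⟨w, hw, hwK⟩ := exists_outer_normal hconv hint hx
  obtain ⟨i₀, hi₀⟩ := hu w hw
  have : Nonempty (Fin N) := ⟨i₀⟩
  let φ : V → ℝ := fun z => Finset.univ.sup' Finset.univ_nonempty fun i => inner ℝ (u i) z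
  have hφ : Continuous φ := Continuous.finset_sup'_apply _ fun i _ => by fun_prop
  have hφx : φ x ≤ r := Finset.sup'_le _ _ fun i _ => hKr x hxK i
  have hpos : 0 < inner ℝ (u i₀) w := (mul_pos hc (norm_pos_iff.2 hw)).trans_le hi₀
  obtain ⟨t, ht, hφt⟩ : ∃ t : ℝ, 0 ≤ t ∧ φ (x + t • w) = r := by
    set T := (r - inner ℝ (u i₀) x) / inner ℝ (u i₀) w with hT
    have hT0 : 0 ≤ T := div_nonneg (sub_nonneg.2 (hKr x hxK i₀)) hpos.le
    have hTr : r ≤ φ (x + T • w) := by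
      refine le_trans (le_of_eq ?_)
        (Finset.le_sup' (fun i => inner ℝ (u i) (x + T • w)) (Finset.mem_univ i₀))
      simp only [inner_add_right, inner_smul_right, hT]
      field_simp
      ring
    have := intermediate_value_Icc hT0 (f := fun t : ℝ => φ (x + t • w)) (by fun_prop)
    obtain ⟨t, ht, h⟩ := this (show r ∈ Icc _ _ from ⟨by simpa using hφx, hTr⟩)
    exact ⟨t, ht.1, h⟩
  refine ⟨x + t • w, ?_, ?_⟩
  · obtain ⟨i, -, hi⟩ := Finset.exists_mem_eq_sup' (Finset.univ_nonempty (α := Fin N))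
      fun i => inner ℝ (u i) (x + t • w)
    refine mem_iUnion.2 ⟨i, hi.symm.trans hφt, fun j => hφt ▸ ?_⟩
    exact Finset.le_sup' (fun i => inner ℝ (u i) (x + t • w)) (Finset.mem_univ j)
  · have h1 := (hp (x + t • w)).2 x hxK
    have h2 : inner ℝ (x + t • w - x) (p (x + t • w) - x) ≤ 0 := by
      rw [add_sub_cancel_left, real_inner_smul_left]
      exact mul_nonpos_of_nonneg_of_nonpos ht (hwK _ (hp _).1)
    have h3 := norm_sub_le_of_inner_nonpos h1 h2
    rw [sub_self, norm_zero] at h3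
    exact sub_eq_zero.1 (norm_le_zero_iff.1 h3)

variable [MeasurableSpace V] [BorelSpace V]

/-- Monotonicity of surface area for a convex body `K` inside the ball of radius `r`, with the
surface area `d |rB| / r` of the ball expressed through its volume. -/
lemma mul_euclideanHausdorffMeasure_frontier_le {K : Set V} (hK : IsClosed K)
    (hconv : Convex ℝ K) (hint : (interior K).Nonempty) {r : ℝ} (hr : 0 < r)
    (hKr : K ⊆ Metric.closedBall 0 r) :
    ENNReal.ofReal (r / Module.finrank ℝ V) * μHE[Module.finrank ℝ V - 1] (frontier K)
      ≤ volume (Metric.closedBall (0 : V) r) := by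
  obtain ⟨p, hp⟩ := exists_metricProjection (hint.mono interior_subset) hK.isComplete hconv
  have hlip : LipschitzWith 1 p := LipschitzWith.of_dist_le_mul fun z z' => by
    rw [dist_eq_norm, dist_eq_norm, NNReal.coe_one, one_mul]
    exact norm_sub_le_of_inner_nonpos ((hp z).2 _ (hp z').1) ((hp z').2 _ (hp z).1)
  have hproj : ∀ (k : ℕ) (s : Set V), (μHE[k] : Measure V) (p '' s) ≤ μHE[k] s := fun k s => by
    have := hlip.hausdorffMeasure_image_le (d := k) (by positivity) s
    simp only [ENNReal.coe_one, ENNReal.one_rpow, one_mul] at this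
    simp only [Measure.euclideanHausdorffMeasure_def, Measure.smul_apply]
    gcongr
  -- The polytope circumscribed about `rB` with normals in an `ε`-net lies in `(1 - ε)⁻¹ rB`.
  have hε : ∀ ε ∈ Ioo (0 : ℝ) 1,
      ENNReal.ofReal (r / Module.finrank ℝ V) * μHE[Module.finrank ℝ V - 1] (frontier K)
        ≤ ENNReal.ofReal ((1 - ε)⁻¹ ^ Module.finrank ℝ V)
          * volume (Metric.closedBall (0 : V) r) := by
    intro ε hε
    have h1ε : 0 < 1 - ε := by linarith [hε.2]
    obtain ⟨N, u, hu1, hu⟩ := exists_finite_net (V := V) hε.1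
    have hsub := frontier_subset_image_facet hK hconv hint hp (r := r) (fun x hx i => by
      refine (real_inner_le_norm _ _).trans ?_
      rw [hu1, one_mul]
      simpa using hKr hx) h1ε hu
    calc _ ≤ ENNReal.ofReal (r / Module.finrank ℝ V) *
            μHE[Module.finrank ℝ V - 1] (⋃ i, facet u r i) := by
          exact mul_le_mul' le_rfl ((measure_mono hsub).trans (hproj _ _))
      _ ≤ volume {x : V | ∀ i, inner ℝ (u i) x ≤ r} :=
          mul_euclideanHausdorffMeasure_iUnion_facet_le hu1 hr
      _ ≤ volume (Metric.closedBall (0 : V) ((1 - ε)⁻¹ * r)) := by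
          refine measure_mono fun x hx => ?_
          rw [mem_closedBall_zero_iff, inv_mul_eq_div, le_div_iff₀' h1ε]
          rcases eq_or_ne x 0 with rfl | hx0
          · simpa using hr.le
          · obtain ⟨i, hi⟩ := hu x hx0
            exact hi.trans (hx i)
      _ = _ := Measure.addHaar_closedBall_mul _ _ (inv_nonneg.2 h1ε.le) hr.le
  have hlim : Filter.Tendsto (fun ε : ℝ => ENNReal.ofReal ((1 - ε)⁻¹ ^ Module.finrank ℝ V)
      * volume (Metric.closedBall (0 : V) r)) (nhdsWithin 0 (Ioi 0))
      (nhds (1 * volume (Metric.closedBall (0 : V) r))) := by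
    refine ENNReal.Tendsto.mul_const ?_ (Or.inl one_ne_zero)
    have hc : ContinuousAt (fun ε : ℝ => (1 - ε)⁻¹ ^ Module.finrank ℝ V) 0 := by
      refine ContinuousAt.pow (ContinuousAt.inv₀ (by fun_prop) (by norm_num)) _
    have := (ENNReal.tendsto_ofReal hc.tendsto).mono_left
      (nhdsWithin_le_nhds (s := Ioi 0))
    simpa using this
  rw [one_mul] at hlim
  refine ge_of_tendsto hlim ?_
  filter_upwards [Ioo_mem_nhdsGT (show (0 : ℝ) < 1 by norm_num)] with ε h using hε ε h

end Projection

/-! ### Caps, cubes and the ball of volume one -/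

section Cap

variable {V : Type*} [NormedAddCommGroup V] [InnerProductSpace ℝ V] [FiniteDimensional ℝ V]
  [MeasurableSpace V] [BorelSpace V]

/-- A cap of the ball of radius `r` at distance `s` from the centre lies in the ball of radius
`√(r² - s²)` about the centre of its base; hence its relative volume is subgaussian. -/
lemma volume_cap_le {v : V} (hv : ‖v‖ = 1) {r s : ℝ} (hr : 0 < r) (hs : 0 ≤ s) :
    volume {x ∈ Metric.closedBall (0 : V) r | s < inner ℝ v x}
      ≤ ENNReal.ofReal (Real.exp (-(Module.finrank ℝ V * s ^ 2 / (2 * r ^ 2))))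
        * volume (Metric.closedBall (0 : V) r) := by
  rcases le_total r s with hrs | hsr
  · have : {x ∈ Metric.closedBall (0 : V) r | s < inner ℝ v x} = ∅ := by
      refine eq_empty_of_forall_notMem fun x hx => ?_
      have h1 := real_inner_le_norm v x
      rw [hv, one_mul] at h1
      have h2 : ‖x‖ ≤ r := by simpa using hx.1
      linarith [hx.2]
    rw [this, measure_empty]
    exact zero_le
  have hq : 0 ≤ 1 - (s / r) ^ 2 := by
    have : s / r ≤ 1 := (div_le_one hr).2 hsr
    nlinarith [div_nonneg hs hr.le]
  have hsub : {x ∈ Metric.closedBall (0 : V) r | s < inner ℝ v x}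
      ⊆ Metric.closedBall (s • v) (√(1 - (s / r) ^ 2) * r) := by
    rintro x ⟨hx, hsx⟩
    rw [mem_closedBall_zero_iff] at hx
    rw [mem_closedBall_iff_norm]
    refine abs_le_of_sq_le_sq' ?_ (by positivity) |>.2
    rw [mul_pow, Real.sq_sqrt hq, norm_sub_sq_real, norm_smul, hv, mul_one, inner_smul_right,
      real_inner_comm, Real.norm_eq_abs, sq_abs]
    have h1 : (1 - (s / r) ^ 2) * r ^ 2 = r ^ 2 - s ^ 2 := by field_simp
    rw [h1]
    nlinarith [norm_nonneg x]
  refine (measure_mono hsub).trans ?_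
  rw [Measure.addHaar_closedBall_mul _ _ (Real.sqrt_nonneg _) hr.le]
  gcongr
  have h2 : √(1 - (s / r) ^ 2) ≤ Real.exp (-(s / r) ^ 2 / 2) := by
    rw [Real.exp_half]
    exact Real.sqrt_le_sqrt (Real.one_sub_le_exp_neg _)
  calc √(1 - (s / r) ^ 2) ^ Module.finrank ℝ V
      ≤ Real.exp (-(s / r) ^ 2 / 2) ^ Module.finrank ℝ V := by gcongr
    _ = _ := by
      rw [← Real.exp_nat_mul]
      congr 1
      field_simp

end Cap

variable {n : ℕ}

/-- The cube `[-s, s]ⁿ`. -/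
def cube (n : ℕ) (s : ℝ) : Set (EuclideanSpace ℝ (Fin n)) :=
  {x | ∀ i, |x i| ≤ s}

lemma smul_supBall {s : ℝ} (hs : 0 < s) : s • supBall n = cube n s := by
  ext x
  rw [mem_smul_set_iff_inv_smul_mem₀ hs.ne']
  simp only [supBall, cube, Set.mem_ofPred_eq, PiLp.smul_apply, smul_eq_mul, abs_mul,
    abs_of_pos (inv_pos.2 hs), inv_mul_le_one₀ hs]

lemma cube_eq_preimage (s : ℝ) :
    cube n s = (WithLp.ofLp : EuclideanSpace ℝ (Fin n) → Fin n → ℝ) ⁻¹'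
      Icc (fun _ => -s) (fun _ => s) := by
  ext x
  simp [cube, abs_le, Pi.le_def, forall_and]

lemma isClosed_cube (s : ℝ) : IsClosed (cube n s) := by
  rw [cube_eq_preimage]
  exact isClosed_Icc.preimage (PiLp.continuous_ofLp 2 _)

lemma convex_cube (s : ℝ) : Convex ℝ (cube n s) := by
  rw [cube_eq_preimage]
  exact (convex_Icc (fun _ : Fin n => -s) (fun _ => s)).is_linear_preimage
    (WithLp.linearEquiv 2 ℝ (Fin n → ℝ)).toLinearMap.isLinear

lemma volume_cube (n : ℕ) (s : ℝ) : volume (cube n s) = ENNReal.ofReal (2 * s) ^ n := by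
  rw [cube_eq_preimage, (PiLp.volume_preserving_ofLp (Fin n)).measure_preimage
    measurableSet_Icc.nullMeasurableSet, Real.volume_Icc_pi]
  simp [two_mul]

lemma cube_mono {s t : ℝ} (h : s ≤ t) : cube n s ⊆ cube n t := fun _ hx i => (hx i).trans h

lemma closedBall_subset_cube (s : ℝ) : Metric.closedBall 0 s ⊆ cube n s := by
  intro x hx i
  rw [mem_closedBall_zero_iff] at hx
  exact (PiLp.norm_apply_le x i).trans hx

lemma omega_pos (n : ℕ) : 0 < omega n :=
  ENNReal.toReal_pos (Metric.measure_closedBall_pos volume _ one_pos).ne'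
    measure_closedBall_lt_top.ne

lemma volume_closedBall_eq (x : EuclideanSpace ℝ (Fin n)) {r : ℝ} (hr : 0 ≤ r) :
    volume (Metric.closedBall x r) = ENNReal.ofReal (r ^ n * omega n) := by
  have h : volume (Metric.closedBall (0 : EuclideanSpace ℝ (Fin n)) 1)
      = ENNReal.ofReal (omega n) :=
    (ENNReal.ofReal_toReal measure_closedBall_lt_top.ne).symm
  have := Measure.addHaar_closedBall_mul (volume : Measure (EuclideanSpace ℝ (Fin n))) x hr
    zero_le_one
  rw [mul_one, finrank_euclideanSpace_fin, h] at this
  rw [this, ENNReal.ofReal_mul (by positivity)]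

/-- The unit ball contains the cube `[-1/√n, 1/√n]ⁿ`. -/
lemma pow_le_omega (hn : 1 ≤ n) : (2 / √n) ^ n ≤ omega n := by
  have hn0 : (0 : ℝ) < n := by exact_mod_cast hn
  have hsub : cube n (1 / √n) ⊆ Metric.closedBall 0 1 := by
    intro x hx
    rw [mem_closedBall_zero_iff, EuclideanSpace.norm_eq, Real.sqrt_le_one]
    calc ∑ i, ‖x i‖ ^ 2 ≤ ∑ _i : Fin n, (1 / √n) ^ 2 := by
          gcongr with i
          exact hx i
      _ = 1 := by
          rw [Finset.sum_const, Finset.card_univ, Fintype.card_fin, div_pow, Real.sq_sqrt hn0.le]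
          simp [hn0.ne']
  have h := measure_mono (μ := volume) hsub
  rw [volume_cube, volume_closedBall_eq _ zero_le_one, one_pow, one_mul,
    ← ENNReal.ofReal_pow (by positivity), ENNReal.ofReal_le_ofReal_iff (omega_pos n).le] at h
  rwa [mul_one_div] at h

/-- The bound obtained by comparing the Gaussian integral of `exp (-n |x|² / 2)` with its part over
the unit ball. -/
lemma omega_le_pow (hn : 1 ≤ n) : omega n ≤ √(2 * Real.pi * Real.exp 1 / n) ^ n := by
  have hn0 : (0 : ℝ) < n := by exact_mod_cast hn
  have hb : (0 : ℝ) < n / 2 := by positivity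
  have hG := GaussianFourier.integral_rexp_neg_mul_sq_norm (V := EuclideanSpace ℝ (Fin n)) hb
  have hint : Integrable fun v : EuclideanSpace ℝ (Fin n) => Real.exp (-(n / 2 : ℝ) * ‖v‖ ^ 2) := by
    refine Integrable.of_integral_ne_zero ?_
    rw [hG]
    positivity
  have hM := mul_meas_ge_le_integral_of_nonneg (ae_of_all _ fun v => (Real.exp_pos _).le) hint
    (Real.exp (-(n / 2 : ℝ)))
  have hω : omega n ≤ volume.real
      {v : EuclideanSpace ℝ (Fin n) |
        Real.exp (-(n / 2 : ℝ)) ≤ Real.exp (-(n / 2 : ℝ) * ‖v‖ ^ 2)} := by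
    refine ENNReal.toReal_mono ?_ (measure_mono fun v hv => ?_)
    · exact (hint.measure_ge_lt_top (Real.exp_pos _)).ne
    · rw [mem_closedBall_zero_iff] at hv
      have : ‖v‖ ^ 2 ≤ 1 := pow_le_one₀ (norm_nonneg _) hv
      exact Real.exp_le_exp.2 (by nlinarith)
  rw [hG, finrank_euclideanSpace_fin] at hM
  have h1 : Real.exp (-(n / 2 : ℝ)) * omega n ≤ (Real.pi / (n / 2)) ^ (n / 2 : ℝ) :=
    (mul_le_mul_of_nonneg_left hω (Real.exp_pos _).le).trans hM
  have h2 : √(2 * Real.pi * Real.exp 1 / n) ^ n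
      = (Real.pi / (n / 2)) ^ (n / 2 : ℝ) * Real.exp (n / 2) := by
    have h3 : 2 * Real.pi * Real.exp 1 / n = Real.pi / (n / 2) * Real.exp 1 := by
      field_simp
    rw [Real.sqrt_eq_rpow, ← Real.rpow_mul_natCast (by positivity), h3,
      Real.mul_rpow (by positivity) (by positivity), ← Real.exp_mul]
    congr 2 <;> ring
  rw [h2]
  calc omega n = Real.exp (-(n / 2 : ℝ)) * omega n * Real.exp (n / 2) := by
        rw [mul_right_comm, ← Real.exp_add]
        simp
    _ ≤ _ := by gcongr

/-- The radius of `D_n`. -/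
noncomputable def radius (n : ℕ) : ℝ := omega n ^ (-1 / (n : ℝ))

lemma radius_pos (n : ℕ) : 0 < radius n := Real.rpow_pos_of_pos (omega_pos n) _

lemma radius_pow (hn : 1 ≤ n) : radius n ^ n = (omega n)⁻¹ := by
  have hn0 : (n : ℝ) ≠ 0 := by positivity
  rw [radius, ← Real.rpow_mul_natCast (omega_pos n).le, div_mul_cancel₀ _ hn0, Real.rpow_neg_one]

lemma volume_closedBall_radius (hn : 1 ≤ n) :
    volume (Metric.closedBall (0 : EuclideanSpace ℝ (Fin n)) (radius n)) = 1 := by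
  rw [volume_closedBall_eq _ (radius_pos n).le, radius_pow hn, inv_mul_cancel₀ (omega_pos n).ne',
    ENNReal.ofReal_one]

lemma radius_sq_le (hn : 1 ≤ n) : radius n ^ 2 ≤ n / 4 := by
  have hn0 : (0 : ℝ) < n := by exact_mod_cast hn
  have h : radius n ≤ √n / 2 := by
    refine (pow_le_pow_iff_left₀ (radius_pos n).le (by positivity) (by omega : n ≠ 0)).1 ?_
    rw [radius_pow hn, ← inv_div, inv_pow]
    exact inv_anti₀ (by positivity) (pow_le_omega hn)
  calc radius n ^ 2 ≤ (√n / 2) ^ 2 := pow_le_pow_left₀ (radius_pos n).le h 2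
    _ = n / 4 := by rw [div_pow, Real.sq_sqrt hn0.le]; norm_num

lemma le_radius_sq (hn : 1 ≤ n) : n / (2 * Real.pi * Real.exp 1) ≤ radius n ^ 2 := by
  have hn0 : (0 : ℝ) < n := by exact_mod_cast hn
  have h : (√(2 * Real.pi * Real.exp 1 / n))⁻¹ ≤ radius n := by
    refine (pow_le_pow_iff_left₀ (by positivity) (radius_pos n).le (by omega : n ≠ 0)).1 ?_
    rw [radius_pow hn, inv_pow]
    exact inv_anti₀ (omega_pos n) (omega_le_pow hn)
  calc n / (2 * Real.pi * Real.exp 1) = ((√(2 * Real.pi * Real.exp 1 / n))⁻¹) ^ 2 := by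
        rw [inv_pow, Real.sq_sqrt (by positivity), inv_div]
    _ ≤ _ := pow_le_pow_left₀ (by positivity) h 2

/-- The volume of `D_n ∩ [-s, s]ⁿ`. -/
noncomputable def truncatedVolume (n : ℕ) (s : ℝ) : ℝ :=
  volume.real (Metric.closedBall 0 (radius n) ∩ cube n s)

lemma volume_truncation_lt_top (s : ℝ) :
    volume (Metric.closedBall 0 (radius n) ∩ cube n s) < ∞ :=
  (measure_mono inter_subset_left).trans_lt measure_closedBall_lt_top

lemma continuousOn_truncatedVolume (n : ℕ) : ContinuousOn (truncatedVolume n) (Ici 0) := by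
  have key : ∀ s t : ℝ, 0 ≤ s → s ≤ t → dist (truncatedVolume n t) (truncatedVolume n s)
      ≤ dist ((2 * t) ^ n) ((2 * s) ^ n) := by
    intro s t hs hst
    -- The increment of the truncated volume is at most that of the volume of the cube.
    have hcube : ∀ a : ℝ, 0 ≤ a → volume.real (cube n a) = (2 * a) ^ n := fun a ha => by
      rw [measureReal_def, volume_cube, ENNReal.toReal_pow, ENNReal.toReal_ofReal (by positivity)]
    have hfin : volume (cube n t) ≠ ∞ := by
      rw [volume_cube]
      exact ENNReal.pow_ne_top ENNReal.ofReal_ne_top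
    have h1 : truncatedVolume n s ≤ truncatedVolume n t :=
      measureReal_mono (inter_subset_inter_right _ (cube_mono hst))
        (volume_truncation_lt_top t).ne
    have h2 : truncatedVolume n t ≤ truncatedVolume n s + volume.real (cube n t \ cube n s) := by
      refine le_trans (measureReal_mono ?_ ?_) (measureReal_union_le _ _)
      · rintro x ⟨hx, hxt⟩
        by_cases hxs : x ∈ cube n s
        · exact Or.inl ⟨hx, hxs⟩
        · exact Or.inr ⟨hxt, hxs⟩
      · exact (measure_union_lt_top (volume_truncation_lt_top s)
          ((measure_mono sdiff_subset).trans_lt hfin.lt_top)).ne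
    rw [measureReal_sdiff (cube_mono hst) (isClosed_cube s).measurableSet hfin,
      hcube t (hs.trans hst), hcube s hs] at h2
    rw [Real.dist_eq, Real.dist_eq, abs_of_nonneg (sub_nonneg.2 h1)]
    exact (by linarith : _ ≤ _).trans (le_abs_self _)
  intro s hs
  have hcont : Filter.Tendsto (fun t : ℝ => dist ((2 * t) ^ n) ((2 * s) ^ n))
      (nhdsWithin s (Ici 0)) (nhds 0) := by
    have : Continuous fun t : ℝ => dist ((2 * t) ^ n) ((2 * s) ^ n) := by fun_prop
    simpa using (this.tendsto s).mono_left nhdsWithin_le_nhds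
  refine tendsto_iff_dist_tendsto_zero.2 (squeeze_zero' (Filter.Eventually.of_forall fun _ =>
    dist_nonneg) ?_ hcont)
  filter_upwards [self_mem_nhdsWithin] with t ht
  rcases le_total s t with h | h
  · exact key s t hs h
  · rw [dist_comm, dist_comm ((2 * t) ^ n)]
    exact key t s ht h

/-- A union bound over the `2n` caps cut off by the cube of half-width `√(log (n + 1))`. -/
lemma half_le_truncatedVolume (hn : 1 ≤ n) :
    1 / 2 ≤ truncatedVolume n √(Real.log (n + 1)) := by
  have hn0 : (0 : ℝ) < n := by exact_mod_cast hn
  set s := √(Real.log (n + 1)) with hs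
  have hs0 : 0 ≤ s := Real.sqrt_nonneg _
  have hs2 : s ^ 2 = Real.log (n + 1) := Real.sq_sqrt (Real.log_nonneg (by linarith))
  have hcap : ∀ v : EuclideanSpace ℝ (Fin n), ‖v‖ = 1 →
      volume.real {x ∈ Metric.closedBall 0 (radius n) | s < inner ℝ v x} ≤ 1 / (n + 1) ^ 2 := by
    intro v hv
    have h := volume_cap_le hv (radius_pos n) hs0
    rw [volume_closedBall_radius hn, mul_one, finrank_euclideanSpace_fin] at h
    refine (ENNReal.toReal_le_of_le_ofReal (Real.exp_pos _).le h).trans ?_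
    have h1 : 2 * s ^ 2 ≤ n * s ^ 2 / (2 * radius n ^ 2) := by
      rw [le_div_iff₀ (by have := radius_pos n; positivity)]
      nlinarith [radius_sq_le hn, sq_nonneg s]
    calc Real.exp (-(n * s ^ 2 / (2 * radius n ^ 2))) ≤ Real.exp (-(2 * s ^ 2)) :=
          Real.exp_le_exp.2 (neg_le_neg h1)
      _ = 1 / (n + 1) ^ 2 := by
          rw [hs2, Real.exp_neg, mul_comm, Real.exp_mul, Real.exp_log (by positivity), one_div]
          norm_cast
  let e : Fin n → EuclideanSpace ℝ (Fin n) := fun i => EuclideanSpace.single i 1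
  let C : EuclideanSpace ℝ (Fin n) → Set (EuclideanSpace ℝ (Fin n)) := fun v =>
    {x ∈ Metric.closedBall 0 (radius n) | s < inner ℝ v x}
  have hcover : Metric.closedBall 0 (radius n) ⊆
      (Metric.closedBall 0 (radius n) ∩ cube n s) ∪ ⋃ i, (C (e i) ∪ C (-e i)) := by
    intro x hx
    by_cases hxs : x ∈ cube n s
    · exact Or.inl ⟨hx, hxs⟩
    · obtain ⟨i, hi⟩ := not_forall.1 hxs
      refine Or.inr (mem_iUnion.2 ⟨i, ?_⟩)
      have hie : inner ℝ (e i) x = x i := by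
        simp [e, EuclideanSpace.inner_single_left]
      rcases lt_abs.1 (not_le.1 hi) with h | h
      · exact Or.inl ⟨hx, by rwa [hie]⟩
      · exact Or.inr ⟨hx, by rwa [inner_neg_left, hie]⟩
  have he : ∀ i, ‖e i‖ = 1 := fun i => by simp [e]
  have hCfin : ∀ v, volume (C v) ≠ ∞ := fun v =>
    ((measure_mono (sep_subset _ _)).trans_lt measure_closedBall_lt_top).ne
  have h1 : (1 : ℝ) ≤ truncatedVolume n s
      + ∑ _i : Fin n, (1 / ((n : ℝ) + 1) ^ 2 + 1 / (n + 1) ^ 2) := by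
    calc (1 : ℝ) = volume.real (Metric.closedBall (0 : EuclideanSpace ℝ (Fin n)) (radius n)) := by
          rw [measureReal_def, volume_closedBall_radius hn, ENNReal.toReal_one]
      _ ≤ volume.real ((Metric.closedBall 0 (radius n) ∩ cube n s)
            ∪ ⋃ i, (C (e i) ∪ C (-e i))) := by
          refine measureReal_mono hcover (measure_union_lt_top (volume_truncation_lt_top s) ?_).ne
          exact (measure_mono (iUnion_subset fun i => union_subset (sep_subset _ _)
            (sep_subset _ _))).trans_lt measure_closedBall_lt_top
      _ ≤ truncatedVolume n s + ∑ i, volume.real (C (e i) ∪ C (-e i)) :=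
          (measureReal_union_le _ _).trans
            (add_le_add le_rfl (measureReal_iUnion_fintype_le _))
      _ ≤ _ := by
          gcongr with i
          refine (measureReal_union_le _ _).trans (add_le_add (hcap _ (he i)) (hcap _ ?_))
          rw [norm_neg, he]
  rw [Finset.sum_const, Finset.card_univ, Fintype.card_fin, nsmul_eq_mul] at h1
  have h2 : (n : ℝ) * (1 / (n + 1) ^ 2 + 1 / (n + 1) ^ 2) ≤ 1 / 2 := by
    rw [← add_div, mul_div_assoc', div_le_div_iff₀ (by positivity) (by norm_num)]
    nlinarith [sq_nonneg ((n : ℝ) - 1)]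
  linarith

/-- The half-width at which the truncated ball has volume `1/2` is at most `√(log (n + 1))`. -/
lemma exists_truncation (hn : 1 ≤ n) : ∃ s : ℝ, 0 < s ∧ s ≤ √(Real.log (n + 1)) ∧
    volume (Metric.closedBall 0 (radius n) ∩ cube n s) = 1 / 2 := by
  have h0 : truncatedVolume n 0 = 0 := by
    rw [truncatedVolume, measureReal_def,
      measure_mono_null inter_subset_right (by rw [volume_cube]; simp; omega), ENNReal.toReal_zero]
  have hivt := intermediate_value_Icc (Real.sqrt_nonneg (Real.log (n + 1)))
    ((continuousOn_truncatedVolume n).mono Icc_subset_Ici_self)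
  obtain ⟨s, hs, hsv⟩ := hivt (show (1 / 2 : ℝ) ∈ Icc _ _ from
    ⟨by rw [h0]; norm_num, half_le_truncatedVolume hn⟩)
  refine ⟨s, hs.1.lt_of_ne ?_, hs.2, ?_⟩
  · rintro rfl
    rw [h0] at hsv
    norm_num at hsv
  · rw [← ENNReal.ofReal_toReal (volume_truncation_lt_top s).ne]
    change ENNReal.ofReal (truncatedVolume n s) = _
    rw [hsv, ENNReal.ofReal_div_of_pos two_pos]
    simp

/-- Hadamard's inequality in volume form: an ellipsoid `T B + b` in the cube `[-s, s]ⁿ` has volume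
at most that of the ball of radius `s`, since the rows of `T` have norm at most `s`. -/
lemma IsEllipsoid.volume_le_of_subset_cube {A : Set (EuclideanSpace ℝ (Fin n))}
    (hA : IsEllipsoid A) {s : ℝ} (hs : 0 ≤ s) (hsub : A ⊆ cube n s) :
    volume A ≤ ENNReal.ofReal (s ^ n * omega n) := by
  obtain ⟨T, b, rfl⟩ := hA
  let e := EuclideanSpace.basisFun (Fin n) ℝ
  let a : Fin n → EuclideanSpace ℝ (Fin n) := fun i =>
    (InnerProductSpace.toDual ℝ _).symm ((EuclideanSpace.proj i).comp (T : _ →L[ℝ] _))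
  have ha : ∀ i x, inner ℝ (a i) x = T x i := fun i x => by
    simp only [a, InnerProductSpace.toDual_symm_apply]
    rfl
  have hnorm : ∀ i, ‖a i‖ ≤ s := by
    intro i
    have hbd : ∀ x : EuclideanSpace ℝ (Fin n), ‖x‖ ≤ 1 → |inner ℝ (a i) x + b i| ≤ s := by
      intro x hx
      have := hsub (mem_image_of_mem _ (mem_closedBall_zero_iff.2 hx)) i
      simpa [ha] using this
    rcases eq_or_ne (a i) 0 with h0 | h0
    · rw [h0, norm_zero]
      exact hs
    · have hx : ‖‖a i‖⁻¹ • a i‖ = 1 := by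
        rw [norm_smul, norm_inv, norm_norm, inv_mul_cancel₀ (norm_ne_zero_iff.2 h0)]
      have hin : inner ℝ (a i) (‖a i‖⁻¹ • a i) = ‖a i‖ := by
        rw [inner_smul_right, real_inner_self_eq_norm_mul_norm,
          inv_mul_cancel_left₀ (norm_ne_zero_iff.2 h0)]
      have h1 := hbd _ hx.le
      have h2 := hbd (-(‖a i‖⁻¹ • a i)) (by rw [norm_neg, hx])
      rw [inner_neg_right, hin] at h2
      rw [hin] at h1
      linarith [(abs_le.1 h1).2, (abs_le.1 h2).1]
  have hdet : |LinearMap.det (T : EuclideanSpace ℝ (Fin n) →ₗ[ℝ] EuclideanSpace ℝ (Fin n))|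
      ≤ s ^ n := by
    have : Fact (Module.finrank ℝ (EuclideanSpace ℝ (Fin n)) = n) :=
      ⟨finrank_euclideanSpace_fin⟩
    have h1 := e.toBasis.orientation.abs_volumeForm_apply_le a
    rw [Orientation.volumeForm_robust' _ e, Module.Basis.det_apply] at h1
    have h2 : e.toBasis.toMatrix a = (LinearMap.toMatrix e.toBasis e.toBasis
        (T : EuclideanSpace ℝ (Fin n) →ₗ[ℝ] EuclideanSpace ℝ (Fin n))).transpose := by
      ext i j
      rw [Matrix.transpose_apply, Module.Basis.toMatrix_apply, LinearMap.toMatrix_apply]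
      simp only [e, OrthonormalBasis.coe_toBasis, OrthonormalBasis.coe_toBasis_repr_apply,
        EuclideanSpace.basisFun_repr, EuclideanSpace.basisFun_apply]
      have := ha j (EuclideanSpace.single i 1)
      rw [EuclideanSpace.inner_single_right] at this
      simpa using this
    rw [h2, Matrix.det_transpose, LinearMap.det_toMatrix] at h1
    refine h1.trans ((Finset.prod_le_prod (fun i _ => norm_nonneg _) fun i _ => hnorm i).trans ?_)
    simp
  have himg : (fun x => T x + b) '' Metric.closedBall 0 1
      = (fun x => x + b) '' (T '' Metric.closedBall 0 1) := by
    rw [image_image]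
  rw [himg, image_add_right, measure_preimage_add_right, Measure.addHaar_image_continuousLinearEquiv,
    volume_closedBall_eq _ zero_le_one, one_pow, one_mul, ENNReal.ofReal_mul (by positivity)]
  gcongr

/-! ### The truncated ball -/

lemma interior_truncation_nonempty {r s : ℝ} (hr : 0 < r) (hs : 0 < s) :
    (interior (Metric.closedBall (0 : EuclideanSpace ℝ (Fin n)) r ∩ cube n s)).Nonempty := by
  refine ⟨0, mem_interior.2 ⟨Metric.ball 0 (min r s), fun x hx => ?_, Metric.isOpen_ball,
    Metric.mem_ball_self (lt_min hr hs)⟩⟩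
  have hx' := Metric.ball_subset_closedBall hx
  exact ⟨Metric.closedBall_subset_closedBall (min_le_left _ _) hx',
    closedBall_subset_cube s (Metric.closedBall_subset_closedBall (min_le_right _ _) hx')⟩

/-- The convex body `rB ∩ [-s, s]ⁿ`. -/
def truncatedBall {r s : ℝ} (hr : 0 ≤ r) (hs : 0 ≤ s) : ConvexBody (EuclideanSpace ℝ (Fin n)) where
  carrier := Metric.closedBall 0 r ∩ cube n s
  convex' := (convex_closedBall 0 r).inter (convex_cube s)
  isCompact' := (isCompact_closedBall 0 r).inter_right (isClosed_cube s)
  nonempty' := ⟨0, Metric.mem_closedBall_self hr, fun i => by simpa using hs⟩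

lemma isOneSymmetric_closedBall_inter_smul_supBall (r s : ℝ) :
    IsOneSymmetric (Metric.closedBall (0 : EuclideanSpace ℝ (Fin n)) r ∩ s • supBall n) := by
  intro g hg
  change g '' supBall n = supBall n at hg
  change g '' _ = _
  rw [image_inter g.injective, image_smul_set g, hg, g.image_closedBall, map_zero]

lemma minSurface_le (K : Set (EuclideanSpace ℝ (Fin n))) :
    minSurface K ≤ surfaceArea K / volume K ^ (((n : ℝ) - 1) / n) := by
  refine (iInf_le _ (ContinuousLinearEquiv.refl ℝ _)).trans_eq ?_
  simp

lemma johnVolume_ne_zero {K : Set (EuclideanSpace ℝ (Fin n))} (hK : (interior K).Nonempty) :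
    johnVolume K ≠ 0 := by
  obtain ⟨b, hb⟩ := hK
  obtain ⟨ε, hε, hsub⟩ := Metric.nhds_basis_closedBall.mem_iff.1 (mem_interior_iff_mem_nhds.1 hb)
  have hell : IsEllipsoid (Metric.closedBall b ε) := by
    refine ⟨ContinuousLinearEquiv.smulLeft (Units.mk0 ε hε.ne'), b, ?_⟩
    have h : (fun x : EuclideanSpace ℝ (Fin n) => (ContinuousLinearEquiv.smulLeft
        (M₁ := EuclideanSpace ℝ (Fin n)) (R₁ := ℝ) (Units.mk0 ε hε.ne')) x + b)
        = (fun x => x + b) ∘ fun x => ε • x := by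
      ext x
      rfl
    rw [h, image_comp, image_smul, smul_unitClosedBall, Real.norm_of_nonneg hε.le]
    simp [image_add_right]
  have h : volume (Metric.closedBall b ε) ≤ johnVolume K :=
    le_iSup₂_of_le (Metric.closedBall b ε) ⟨hell, hsub⟩ le_rfl
  exact ((Metric.measure_closedBall_pos volume b hε).trans_le h).ne'

lemma johnVolume_le {K : Set (EuclideanSpace ℝ (Fin n))} {s : ℝ} (hs : 0 ≤ s) (hK : K ⊆ cube n s) :
    johnVolume K ≤ ENNReal.ofReal (s ^ n * omega n) :=
  iSup₂_le fun _ hA => hA.1.volume_le_of_subset_cube hs (hA.2.trans hK)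

lemma volumeRatio_ne_top {K : Set (EuclideanSpace ℝ (Fin n))} (hK : (interior K).Nonempty)
    (hvol : volume K ≠ ∞) : volumeRatio K ≠ ∞ :=
  ENNReal.rpow_ne_top_of_nonneg (by positivity)
    (ENNReal.div_ne_top hvol (johnVolume_ne_zero hK))

lemma le_volumeRatio (hn : 1 ≤ n) {K : Set (EuclideanSpace ℝ (Fin n))} {s : ℝ} (hs : 0 < s)
    (hK : K ⊆ cube n s) (hvol : volume K = 1 / 2) :
    ENNReal.ofReal (radius n / (2 * s)) ≤ volumeRatio K := by
  have hω := omega_pos n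
  have hr := radius_pos n
  have hn0 : n ≠ 0 := by omega
  -- This compares `n`-th powers; `2 ≤ 2 ^ n` absorbs the volume `1/2` of `K`.
  have h1 : (radius n / (2 * s)) ^ n ≤ 1 / 2 / (s ^ n * omega n) := by
    rw [div_pow, radius_pow hn, mul_pow, inv_eq_one_div, div_div, div_div]
    have h2 : (2 : ℝ) ≤ 2 ^ n := by
      calc (2 : ℝ) = 2 ^ 1 := (pow_one 2).symm
        _ ≤ 2 ^ n := pow_le_pow_right₀ one_le_two hn
    refine one_div_le_one_div_of_le (by positivity) ?_
    nlinarith [mul_le_mul_of_nonneg_right h2 (by positivity : 0 ≤ s ^ n * omega n)]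
  rw [volumeRatio, hvol, one_div (n : ℝ), ENNReal.le_rpow_inv_iff (by positivity),
    ENNReal.rpow_natCast, ← ENNReal.ofReal_pow (by positivity)]
  calc ENNReal.ofReal ((radius n / (2 * s)) ^ n)
      ≤ ENNReal.ofReal (1 / 2 / (s ^ n * omega n)) := ENNReal.ofReal_le_ofReal h1
    _ = 1 / 2 / ENNReal.ofReal (s ^ n * omega n) := by
        rw [ENNReal.ofReal_div_of_pos (by positivity), ENNReal.ofReal_div_of_pos two_pos]
        simp
    _ ≤ _ := ENNReal.div_le_div_left (johnVolume_le hs.le hK) _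

lemma surfaceArea_le (hn : 1 ≤ n) {K : Set (EuclideanSpace ℝ (Fin n))} (hK : IsClosed K)
    (hconv : Convex ℝ K) (hint : (interior K).Nonempty)
    (hsub : K ⊆ Metric.closedBall 0 (radius n)) :
    surfaceArea K ≤ ENNReal.ofReal (n / radius n) := by
  have hr := radius_pos n
  have hn0 : (0 : ℝ) < n := by exact_mod_cast hn
  have h := mul_euclideanHausdorffMeasure_frontier_le hK hconv hint hr hsub
  rw [volume_closedBall_radius hn, finrank_euclideanSpace_fin, mul_comm,
    ← ENNReal.le_div_iff_mul_le (Or.inl (by simp; positivity)) (Or.inl ENNReal.ofReal_ne_top),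
    ← ENNReal.ofReal_one, ← ENNReal.ofReal_div_of_pos (by positivity), one_div_div] at h
  exact h

/-- For `s ≤ √(log (n + 1))`, surface area at most `n / r` and volume ratio at least `r / (2 s)`
combine, as `r²` is of order `n`. -/
lemma minSurface_le_mul_volumeRatio (hn : 1 ≤ n) {K : Set (EuclideanSpace ℝ (Fin n))}
    (hK : IsClosed K) (hconv : Convex ℝ K) (hint : (interior K).Nonempty) {s : ℝ} (hs : 0 < s)
    (hslog : s ≤ √(Real.log (n + 1))) (hball : K ⊆ Metric.closedBall 0 (radius n))
    (hcube : K ⊆ cube n s) (hvol : volume K = 1 / 2) :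
    minSurface K ≤ ENNReal.ofReal (8 * Real.pi * Real.exp 1) * volumeRatio K *
      ENNReal.ofReal √(Real.log (n + 1)) := by
  have hr := radius_pos n
  have hn0 : (0 : ℝ) < n := by exact_mod_cast hn
  have hexp : ((n : ℝ) - 1) / n ≤ 1 := by
    rw [div_le_one hn0]
    linarith
  have hhalf : (2 : ℝ≥0∞)⁻¹ ≤ 2⁻¹ ^ (((n : ℝ) - 1) / n) := by
    have := ENNReal.rpow_le_rpow_of_exponent_ge (x := 2⁻¹)
      (ENNReal.inv_le_one.2 one_le_two) hexp
    rwa [ENNReal.rpow_one] at this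
  have hreal : n / radius n * 2 ≤ 8 * Real.pi * Real.exp 1 * (radius n / (2 * s))
      * √(Real.log (n + 1)) := by
    have h1 : n ≤ 2 * Real.pi * Real.exp 1 * radius n ^ 2 := by
      have := le_radius_sq hn
      rwa [div_le_iff₀' (by positivity)] at this
    calc n / radius n * 2 ≤ 2 * Real.pi * Real.exp 1 * radius n ^ 2 / radius n * 2 := by gcongr
      _ = 8 * Real.pi * Real.exp 1 * (radius n / (2 * s)) * s := by
        field_simp
        ring
      _ ≤ _ := by gcongr
  calc minSurface K ≤ surfaceArea K / volume K ^ (((n : ℝ) - 1) / n) := minSurface_le K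
    _ ≤ ENNReal.ofReal (n / radius n) / 2⁻¹ := by
        rw [hvol, one_div]
        exact ENNReal.div_le_div (surfaceArea_le hn hK hconv hint hball) hhalf
    _ = ENNReal.ofReal (n / radius n * 2) := by
        rw [div_eq_mul_inv, inv_inv, ENNReal.ofReal_mul (by positivity), ENNReal.ofReal_ofNat]
    _ ≤ ENNReal.ofReal (8 * Real.pi * Real.exp 1 * (radius n / (2 * s))
          * √(Real.log (n + 1))) := ENNReal.ofReal_le_ofReal hreal
    _ = ENNReal.ofReal (8 * Real.pi * Real.exp 1) * ENNReal.ofReal (radius n / (2 * s))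
          * ENNReal.ofReal √(Real.log (n + 1)) := by
        rw [ENNReal.ofReal_mul (by positivity), ENNReal.ofReal_mul (by positivity)]
    _ ≤ _ := by
        gcongr
        exact le_volumeRatio hn hs hcube hvol

lemma exists_mul_sqrt_log_lt_mul_sqrt {c c' : ℝ} (hc : 0 < c) (hc' : 0 < c') :
    ∃ n : ℕ, 1 ≤ n ∧ c' * √(Real.log (n + 1)) < c * √n := by
  have h := (Real.isLittleO_log_id_atTop.bound (show 0 < (c / c') ^ 2 / 4 by positivity))
  obtain ⟨n, hn1, hn⟩ := ((Filter.eventually_ge_atTop 1).and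
    ((Filter.tendsto_atTop_add_const_right _ (1 : ℝ) tendsto_natCast_atTop_atTop).eventually
      h)).exists
  refine ⟨n, hn1, ?_⟩
  have hn0 : (1 : ℝ) ≤ n := by exact_mod_cast hn1
  simp only [id, Real.norm_eq_abs, abs_of_nonneg (Real.log_nonneg (by linarith : (1 : ℝ) ≤ n + 1)),
    abs_of_pos (by linarith : (0 : ℝ) < n + 1)] at hn
  have h1 : Real.log (n + 1) < (c / c') ^ 2 * n := by
    have : 0 < (c / c') ^ 2 := by positivity
    nlinarith
  calc c' * √(Real.log (n + 1)) < c' * √((c / c') ^ 2 * n) := by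
        gcongr
        exact Real.log_nonneg (by linarith)
    _ = c * √n := by
        rw [Real.sqrt_mul (by positivity), Real.sqrt_sq (by positivity)]
        field_simp

end MinSurf

theorem mainTheorem4 :
    (∃ c' : ℝ, 0 < c' ∧ ∀ n : ℕ, 1 ≤ n →
      ∃ s₀ : ℝ, 0 < s₀ ∧ ∃ K : ConvexBody (EuclideanSpace ℝ (Fin n)),
        (K : Set (EuclideanSpace ℝ (Fin n))) =
            MinSurf.unitVolumeBall n ∩ s₀ • MinSurf.supBall n ∧
        volume (K : Set (EuclideanSpace ℝ (Fin n))) = 1 / 2 ∧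
        (interior (K : Set (EuclideanSpace ℝ (Fin n)))).Nonempty ∧
        MinSurf.IsOneSymmetric (K : Set (EuclideanSpace ℝ (Fin n))) ∧
        MinSurf.minSurface (K : Set (EuclideanSpace ℝ (Fin n))) ≤
          ENNReal.ofReal c' * MinSurf.volumeRatio (K : Set (EuclideanSpace ℝ (Fin n))) *
            ENNReal.ofReal (Real.sqrt (Real.log ((n : ℝ) + 1)))) ∧
    ¬ ∃ c : ℝ, 0 < c ∧ ∀ n : ℕ, 1 ≤ n → ∀ K : ConvexBody (EuclideanSpace ℝ (Fin n)),
        (interior (K : Set (EuclideanSpace ℝ (Fin n)))).Nonempty → (∀ x ∈ K, -x ∈ K) →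
        ENNReal.ofReal (c * Real.sqrt n) *
            MinSurf.volumeRatio (K : Set (EuclideanSpace ℝ (Fin n))) ≤
          MinSurf.minSurface (K : Set (EuclideanSpace ℝ (Fin n))) := by
  have hc' : (0 : ℝ) < 8 * Real.pi * Real.exp 1 := by positivity
  have main : ∀ n : ℕ, 1 ≤ n → ∃ (s : ℝ) (_ : 0 < s) (K : ConvexBody (EuclideanSpace ℝ (Fin n))),
      (K : Set (EuclideanSpace ℝ (Fin n))) =
        Metric.closedBall 0 (MinSurf.radius n) ∩ MinSurf.cube n s ∧
      volume (K : Set (EuclideanSpace ℝ (Fin n))) = 1 / 2 ∧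
      (interior (K : Set (EuclideanSpace ℝ (Fin n)))).Nonempty ∧
      0 < MinSurf.volumeRatio (K : Set (EuclideanSpace ℝ (Fin n))) ∧
      MinSurf.minSurface (K : Set (EuclideanSpace ℝ (Fin n))) ≤
        ENNReal.ofReal (8 * Real.pi * Real.exp 1) *
          MinSurf.volumeRatio (K : Set (EuclideanSpace ℝ (Fin n))) *
          ENNReal.ofReal (Real.sqrt (Real.log ((n : ℝ) + 1))) := by
    intro n hn
    obtain ⟨s, hs, hslog, hvol⟩ := MinSurf.exists_truncation hn
    have hr := MinSurf.radius_pos n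
    let K : ConvexBody (EuclideanSpace ℝ (Fin n)) := MinSurf.truncatedBall hr.le hs.le
    have hint := MinSurf.interior_truncation_nonempty (n := n) hr hs
    exact ⟨s, hs, K, rfl, hvol, hint,
      (ENNReal.ofReal_pos.2 (by positivity)).trans_le
        (MinSurf.le_volumeRatio hn hs inter_subset_right hvol),
      MinSurf.minSurface_le_mul_volumeRatio hn K.isClosed K.convex hint hs hslog
        inter_subset_left inter_subset_right hvol⟩
  refine ⟨⟨_, hc', fun n hn => ?_⟩, ?_⟩
  · obtain ⟨s, hs, K, hK, hvol, hint, -, hle⟩ := main n hn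
    have hK' : (K : Set (EuclideanSpace ℝ (Fin n))) =
        MinSurf.unitVolumeBall n ∩ s • MinSurf.supBall n := by
      rw [hK, MinSurf.smul_supBall hs]
      rfl
    refine ⟨s, hs, K, hK', hvol, hint, ?_, hle⟩
    rw [hK']
    exact MinSurf.isOneSymmetric_closedBall_inter_smul_supBall _ s
  · rintro ⟨c, hc, hrev⟩
    obtain ⟨n, hn, hlt⟩ := MinSurf.exists_mul_sqrt_log_lt_mul_sqrt hc hc'
    obtain ⟨s, hs, K, hK, hvol, hint, hpos, hle⟩ := main n hn
    have hsymm : ∀ x ∈ K, -x ∈ K := by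
      intro x hx
      change x ∈ (K : Set (EuclideanSpace ℝ (Fin n))) at hx
      change -x ∈ (K : Set (EuclideanSpace ℝ (Fin n)))
      rw [hK] at hx ⊢
      exact ⟨by simpa using hx.1, fun i => by simpa using hx.2 i⟩
    have hfin := MinSurf.volumeRatio_ne_top hint (by rw [hvol]; simp)
    have h := (hrev n hn K hint hsymm).trans hle
    -- The volume ratio is positive and finite, so it cancels.
    rw [mul_right_comm, ENNReal.mul_le_mul_iff_left hpos.ne' hfin,
      ← ENNReal.ofReal_mul hc'.le, ENNReal.ofReal_le_ofReal_iff (by positivity)] at h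
    exact hlt.not_ge h
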